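/- Let $m\ge n$ be natural numbers, $a>0$, $\tau>0$, and $\rho_a(t)=\frac{a|t|}{a|t|+1}$ for $t\in\mathbb{R}$. For $Z\in\mathbb{R}^{m\times n}$ let $\sigma(Z)=(\sigma_1(Z),\dots,\sigma_n(Z))$ be the vector of its singular values in descending order. Let $$N=U\begin{bmatrix}\mathrm{Diag}(\sigma(N))\\ \mathbf 0_{(m-n)\times n}\end{bmatrix}V^{\top}$$ be a singular value decomposition of $N\in\mathbb{R}^{m\times n}$, with $U\in\mathbb{R}^{m\times m}$ and $V\in\mathbb{R}^{n\times n}$ orthogonal. Let $h:\mathbb{R}\to\mathbb{R}$ be a scalar proximal operator of $\tau\rho_a$, that is, $$h(\gamma)\in\arg\min_{\beta\in\mathbb{R}}\Big\{\tfrac12(\beta-\gamma)^2+\tau\rho_a(\beta)\Big\}\quad\text{for every }\gamma\in\mathbb{R},$$ or let $h$ be the explicit function with $$h(\gamma)=\mathrm{sign}(\gamma)\,\frac{\frac{1+a|\gamma|}{3}\Big(1+2\cos\big(\frac{\phi(\gamma)}{3}-\frac{\pi}{3}\big)\Big)-1}{a}\ \text{ if }|\gamma|>t_{a,\tau},\qquad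 h(\gamma)=0\ \text{ if }|\gamma|\le t_{a,\tau},$$ where $\phi(\gamma)=\arccos\Big(\frac{27\tau a^2}{2(1+a|\gamma|)^3}-1\Big)$, and $t_{a,\tau}=\tau a$ if $\tau\le\frac{1}{2a^2}$, $t_{a,\tau}=\sqrt{2\tau}-\frac1{2a}$ if $\tau>\frac1{2a^2}$. In either case the matrix $$\mathcal{G}_{a,\tau}(N)=U\begin{bmatrix}\mathrm{Diag}\big(h(\sigma_1(N)),\dots,h(\sigma_n(N))\big)\\ \mathbf 0_{(m-n)\times n}\end{bmatrix}V^{\top}$$ is a minimizer over $Z\in\mathbb{R}^{m\times n}$ of $$\frac12\|Z-N\|_F^2+\tau\sum_{i=1}^n\rho_a(\sigma_i(Z)).$$ -/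

import Mathlib

open scoped Matrix

noncomputable section

namespace FractionThresholding

/-- The fraction function `ρ_a(t) = a|t| / (a|t| + 1)`. -/
def rho (a t : ℝ) : ℝ := a * |t| / (a * |t| + 1)

/-- The scalar objective `β ↦ (β - γ)² / 2 + τ ρ_a(β)`. -/
def scalarObjective (a τ γ β : ℝ) : ℝ := 1 / 2 * (β - γ) ^ 2 + τ * rho a β

/-- `h` is a scalar proximal operator: for every `γ`, the value `h γ` belongs to
`argmin_β scalarObjective a τ γ β`. -/
def IsScalarProx (a τ : ℝ) (h : ℝ → ℝ) : Prop :=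
  ∀ γ : ℝ, IsMinOn (scalarObjective a τ γ) Set.univ (h γ)

/-- The threshold value `t_{a,τ}`. -/
def threshold (a τ : ℝ) : ℝ :=
  if τ ≤ 1 / (2 * a ^ 2) then τ * a else √(2 * τ) - 1 / (2 * a)

/-- The angle `φ(γ) = arccos (27 τ a² / (2 (1 + a|γ|)³) - 1)`. -/
def angle (a τ γ : ℝ) : ℝ :=
  Real.arccos (27 * τ * a ^ 2 / (2 * (1 + a * |γ|) ^ 3) - 1)

/-- The function `g_{a,τ}`. -/
def shrink (a τ γ : ℝ) : ℝ :=
  Real.sign γ *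
    (((1 + a * |γ|) / 3 * (1 + 2 * Real.cos (angle a τ γ / 3 - Real.pi / 3)) - 1) / a)

open Classical in
/-- The closed form of the scalar proximal operator `h_{f_{a,τ}}`, with the value `0` at the
threshold. -/
def scalarProx (a τ γ : ℝ) : ℝ :=
  if threshold a τ < |γ| then shrink a τ γ else 0

/-- The vector `σ(Z)` of the `n` singular values of an `m × n` matrix, in descending order. -/
def singularVector {m n : ℕ} (Z : Matrix (Fin m) (Fin n) ℝ) : Fin n → ℝ :=
  fun i => (Matrix.toEuclideanLin Z).singularValues i

/-- The `m × n` matrix whose top `n × n` block is `Diag(d)` and whose other rows vanish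
(for `n ≤ m`). -/
def rectDiag (m : ℕ) {n : ℕ} (d : Fin n → ℝ) : Matrix (Fin m) (Fin n) ℝ :=
  Matrix.of fun l j => if (l : ℕ) = (j : ℕ) then d j else 0

/-- `N = U [Diag(σ(N)); 0] Vᵀ` is a singular value decomposition of `N`. -/
structure IsSVD {m n : ℕ} (N : Matrix (Fin m) (Fin n) ℝ) (U : Matrix (Fin m) (Fin m) ℝ)
    (V : Matrix (Fin n) (Fin n) ℝ) : Prop where
  left_orthogonal : U ∈ Matrix.orthogonalGroup (Fin m) ℝ
  right_orthogonal : V ∈ Matrix.orthogonalGroup (Fin n) ℝ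
  eq : N = U * rectDiag m (singularVector N) * Vᵀ

/-- The vector thresholding operator: `h` applied to each entry. -/
def vectorThreshold {n : ℕ} (h : ℝ → ℝ) (x : Fin n → ℝ) : Fin n → ℝ := fun i => h (x i)

/-- The singular value thresholding of `N` with scalar operator `h`, computed from the
orthogonal factors `U` and `V` of a singular value decomposition of `N`. -/
def singularValueThreshold {m n : ℕ} (h : ℝ → ℝ) (N : Matrix (Fin m) (Fin n) ℝ)
    (U : Matrix (Fin m) (Fin m) ℝ) (V : Matrix (Fin n) (Fin n) ℝ) : Matrix (Fin m) (Fin n) ℝ :=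
  U * rectDiag m (vectorThreshold h (singularVector N)) * Vᵀ

section Objective

open scoped Matrix.Norms.Frobenius

/-- The matrix objective `Z ↦ ‖Z - N‖_F² / 2 + τ ∑ᵢ ρ_a(σᵢ(Z))`, with the Frobenius norm. -/
def matrixObjective {m n : ℕ} (a τ : ℝ) (N Z : Matrix (Fin m) (Fin n) ℝ) : ℝ :=
  1 / 2 * ‖Z - N‖ ^ 2 + τ * ∑ i : Fin n, rho a (singularVector Z i)

end Objective

end FractionThresholding

end

/-!
Write `e(γ)` for the minimum over `β` of the scalar objective. The claim is that the minimum of the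
matrix objective is `∑ e(σᵢ(N))`, attained at the thresholded matrix `G`.

The value at `G` is direct: `‖G - N‖²` is `∑ (h(σᵢ) - σᵢ)²` by orthogonal invariance, and the squared
singular values of `G` are the numbers `h(σᵢ)²` up to order, being the roots of the characteristic
polynomial of `Gᵀ G` (`sum_singularVector_sq_mul_rectDiag_mul`).

The lower bound needs no sorting or rearrangement. Expanding along singular bases of `Z` and `N`, the
Frobenius inner product of `Z` and `N` is `∑ sⱼ σᵢ pⱼᵢ qⱼᵢ`, where `s = σ(Z)`, `σ = σ(N)`, and the
squares of `p` and of `q` form doubly substochastic matrices. By weak duality for the assignment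
problem it is at most `∑ fⱼ + ∑ gᵢ` for every pair of nonnegative vectors with `fⱼ + gᵢ ≥ sⱼ σᵢ`
(`half_sq_sub_le_half_frobenius_norm_sub_sq`). The choice `fⱼ = sⱼ² / 2 + τ ρ(sⱼ)`,
`gᵢ = σᵢ² / 2 - e(σᵢ)` is feasible by the definition of `e`, and turns the bound into the one wanted.

That `scalarProx` attains `e(γ)` for `γ ≥ 0` rests on two factorizations. The objective at `β ≥ 0` minus
that at `0` is `β (β / 2 + τ a / (a β + 1) - γ)`, and `threshold` is the infimum of
`β / 2 + τ a / (a β + 1)`, so it separates the `γ` at which `0` is optimal. Above it, with `b` a root of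
the cubic stationarity equation, the objective is up to a constant
`(x - b)² (1 / 2 - a (γ - b) / (a x + 1))`; for the largest root this is least at `b` as soon as `0`
is not optimal (`isMinOn_of_stationary`).
-/

namespace FractionThresholding

open scoped Matrix Matrix.Norms.Frobenius
open Module

/-! ### The scalar minimization problem -/

theorem rho_nonneg {a : ℝ} (ha : 0 < a) (t : ℝ) : 0 ≤ rho a t := by
  unfold rho; positivity

theorem rho_abs (a t : ℝ) : rho a |t| = rho a t := by
  unfold rho; rw [abs_abs]

theorem scalarObjective_sub_zero {a τ γ β : ℝ} (ha : 0 < a) (hβ : 0 ≤ β) :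
    scalarObjective a τ γ β - scalarObjective a τ γ 0 =
      β * (β / 2 + τ * a / (a * β + 1) - γ) := by
  have : a * β + 1 ≠ 0 := by positivity
  simp only [scalarObjective, rho, abs_of_nonneg hβ, abs_zero]
  field_simp
  ring

theorem isMinOn_scalarObjective_of_nonneg {a τ γ b : ℝ} (hγ : 0 ≤ γ)
    (h : ∀ β, 0 ≤ β → scalarObjective a τ γ b ≤ scalarObjective a τ γ β) :
    IsMinOn (scalarObjective a τ γ) Set.univ b := by
  intro β _
  refine (h |β| (abs_nonneg β)).trans ?_
  simp only [scalarObjective, rho_abs]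
  have h1 := mul_le_mul_of_nonneg_right (le_abs_self β) hγ
  nlinarith [sq_abs β]

theorem isMinOn_zero_of_le_threshold {a τ γ : ℝ} (ha : 0 < a) (hτ : 0 < τ) (hγ : 0 ≤ γ)
    (h : γ ≤ threshold a τ) : IsMinOn (scalarObjective a τ γ) Set.univ 0 := by
  refine isMinOn_scalarObjective_of_nonneg hγ fun β hβ => ?_
  rw [← sub_nonneg, scalarObjective_sub_zero ha hβ]
  refine mul_nonneg hβ (sub_nonneg.mpr (h.trans ?_))
  have hp : 0 < a * β + 1 := by positivity
  unfold threshold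
  split_ifs with hc
  · rw [le_div_iff₀ (by positivity)] at hc
    rw [← sub_nonneg]
    have : β / 2 + τ * a / (a * β + 1) - τ * a =
        β * (a * β + (1 - τ * (2 * a ^ 2))) / (2 * (a * β + 1)) := by
      field_simp; ring
    rw [this]
    exact div_nonneg (mul_nonneg hβ (add_nonneg (by positivity) (by linarith))) (by positivity)
  · have hr : √(2 * τ) ^ 2 = 2 * τ := Real.sq_sqrt (by positivity)
    rw [← sub_nonneg]
    have : β / 2 + τ * a / (a * β + 1) - (√(2 * τ) - 1 / (2 * a)) =
        (a * β + 1 - a * √(2 * τ)) ^ 2 / (2 * a * (a * β + 1)) := by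
      -- Write `τ` as `√(2 * τ) ^ 2 / 2` so that the identity is rational in `√(2 * τ)`.
      rw [show τ = √(2 * τ) ^ 2 / 2 by linarith]
      rw [show √(2 * (√(2 * τ) ^ 2 / 2)) = √(2 * τ) by rw [hr]; ring_nf]
      field_simp; ring
    rw [this]
    positivity

/-- On the second branch of `threshold`, the point `β = √(2τ) - 1 / a` is positive. -/
theorem inv_lt_sqrt_two_mul {a τ : ℝ} (ha : 0 < a) (hc : 1 / (2 * a ^ 2) < τ) :
    1 / a < √(2 * τ) := by
  refine Real.lt_sqrt_of_sq_lt ?_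
  calc (1 / a) ^ 2 = 2 * (1 / (2 * a ^ 2)) := by field_simp
    _ < 2 * τ := by linarith

theorem threshold_pos {a τ : ℝ} (ha : 0 < a) (hτ : 0 < τ) : 0 < threshold a τ := by
  unfold threshold
  split_ifs with hc
  · positivity
  · have h := inv_lt_sqrt_two_mul ha (not_le.mp hc)
    have h1 : 1 / (2 * a) < 1 / a := by
      gcongr
      linarith
    linarith

/-- Above the threshold, `0` is not a minimizer. -/
theorem exists_scalarObjective_lt_zero {a τ γ : ℝ} (ha : 0 < a) (hτ : 0 < τ)
    (h : threshold a τ < γ) :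
    ∃ β, 0 < β ∧ scalarObjective a τ γ β < scalarObjective a τ γ 0 := by
  suffices ∃ β, 0 < β ∧ β / 2 + τ * a / (a * β + 1) < γ by
    obtain ⟨β, hβ, h1⟩ := this
    refine ⟨β, hβ, ?_⟩
    rw [← sub_neg, scalarObjective_sub_zero ha hβ.le]
    exact mul_neg_of_pos_of_neg hβ (by linarith)
  unfold threshold at h
  split_ifs at h with hc
  · -- Near `0` the slope of the objective is `τ * a - γ < 0`; the point `γ - τ * a` is small enough.
    have hβ : 0 < γ - τ * a := by linarith
    refine ⟨γ - τ * a, hβ, ?_⟩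
    have : τ * a / (a * (γ - τ * a) + 1) ≤ τ * a :=
      div_le_self (by positivity) (le_add_of_nonneg_left (by positivity))
    linarith
  · have hr : √(2 * τ) ^ 2 = 2 * τ := Real.sq_sqrt (by positivity)
    have hr0 : 0 < √(2 * τ) := Real.sqrt_pos.mpr (by positivity)
    -- This is where `β / 2 + τ * a / (a * β + 1)` attains its minimum, namely the threshold.
    refine ⟨√(2 * τ) - 1 / a, sub_pos.mpr (inv_lt_sqrt_two_mul ha (not_le.mp hc)), ?_⟩
    refine lt_of_eq_of_lt ?_ h
    have h1 : a * (√(2 * τ) - 1 / a) + 1 = a * √(2 * τ) := by field_simp; ring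
    have h2 : τ * a / (a * √(2 * τ)) = √(2 * τ) / 2 := by
      rw [div_eq_div_iff (by positivity) two_ne_zero]
      linear_combination (-a) * hr
    rw [h1, h2]
    field_simp
    ring

/-- Above the threshold, the argument of `arccos` in `angle` is at most `1`. -/
theorem le_four_mul_cube_of_threshold_lt {a τ γ : ℝ} (ha : 0 < a) (hτ : 0 < τ)
    (h : threshold a τ < γ) :
    27 * τ * a ^ 2 ≤ 4 * (1 + a * γ) ^ 3 := by
  unfold threshold at h
  split_ifs at h with hc
  · have h1 : 1 + τ * a ^ 2 ≤ 1 + a * γ := by nlinarith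
    have h2 : (1 + τ * a ^ 2) ^ 3 ≤ (1 + a * γ) ^ 3 := by gcongr
    -- `4 (1 + k)³ - 27 k = (2 k - 1)² (k + 4)` with `k = τ a²`.
    nlinarith [mul_nonneg (sq_nonneg (2 * (τ * a ^ 2) - 1)) (by positivity : 0 ≤ τ * a ^ 2 + 4)]
  · have hr : √(2 * τ) ^ 2 = 2 * τ := Real.sq_sqrt (by positivity)
    set x := a * √(2 * τ) with hx
    have hx0 : 0 ≤ x := by positivity
    have hx2 : x ^ 2 = 2 * (τ * a ^ 2) := by rw [hx, mul_pow, hr]; ring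
    have h1 : x + 1 / 2 ≤ 1 + a * γ := by
      have := mul_lt_mul_of_pos_left h ha
      have h3 : a * (√(2 * τ) - 1 / (2 * a)) = x - 1 / 2 := by rw [hx]; field_simp
      linarith
    have h2 : (x + 1 / 2) ^ 3 ≤ (1 + a * γ) ^ 3 := by gcongr
    -- `4 (x + 1 / 2)³ - 27 / 2 x² = 4 (x - 1)² (x + 1 / 8)`.
    nlinarith [mul_nonneg (sq_nonneg (x - 1)) (by positivity : 0 ≤ x + 1 / 8)]

/-- Viète's trigonometric formula for the largest root of `s³ - c s² + k`. -/
theorem cubic_trig_root {c k s : ℝ} (hc : 0 < c) (hk : 0 < k) (h : 27 * k ≤ 4 * c ^ 3)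
    (hs : s = c / 3 * (1 + 2 * Real.cos
      (Real.arccos (27 * k / (2 * c ^ 3) - 1) / 3 - Real.pi / 3))) :
    s ^ 2 * (c - s) = k ∧ 2 * c / 3 ≤ s := by
  set φ := Real.arccos (27 * k / (2 * c ^ 3) - 1) with hφ
  set θ := φ / 3 - Real.pi / 3 with hθ
  have hcos : Real.cos φ = 27 * k / (2 * c ^ 3) - 1 := by
    refine Real.cos_arccos ?_ ?_
    · have : 0 < 27 * k / (2 * c ^ 3) := by positivity
      linarith
    · rw [sub_le_iff_le_add, div_le_iff₀ (by positivity)]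
      linarith
  have h3 : 4 * Real.cos θ ^ 3 - 3 * Real.cos θ = 1 - 27 * k / (2 * c ^ 3) := by
    rw [← Real.cos_three_mul, show 3 * θ = φ - Real.pi by rw [hθ]; ring, Real.cos_sub_pi, hcos]
    ring
  constructor
  · have : k = 2 * c ^ 3 / 27 * (1 - (4 * Real.cos θ ^ 3 - 3 * Real.cos θ)) := by
      rw [h3]; field_simp; ring
    rw [this, hs]
    ring
  · -- `θ` lies in `[-π / 3, 0]`.
    have h1 : 1 / 2 ≤ Real.cos θ := by
      rw [← Real.cos_pi_div_three, ← Real.cos_neg θ]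
      have h0 := Real.arccos_nonneg (27 * k / (2 * c ^ 3) - 1)
      have hp := Real.arccos_le_pi (27 * k / (2 * c ^ 3) - 1)
      have := Real.pi_pos
      exact Real.cos_le_cos_of_nonneg_of_le_pi (by linarith) (by linarith) (by linarith)
    rw [hs]
    nlinarith

/-- With `b` a root of the stationarity equation, the objective on `[0, ∞)` is, up to a constant,
`(x - b)² (1 / 2 - a (γ - b) / (a x + 1))`. The root `b` itself may be negative. -/
theorem scalarObjective_sub_of_nonneg {a τ γ b x y : ℝ} (ha : 0 < a) (hx : 0 ≤ x) (hy : 0 ≤ y)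
    (hb : (1 + a * b) ^ 2 * (a * (γ - b)) = τ * a ^ 2) :
    scalarObjective a τ γ x - scalarObjective a τ γ y =
      (x - b) ^ 2 * (1 / 2 - a * (γ - b) / (a * x + 1)) -
        (y - b) ^ 2 * (1 / 2 - a * (γ - b) / (a * y + 1)) := by
  have h1 : a * x + 1 ≠ 0 := by positivity
  have h2 : a * y + 1 ≠ 0 := by positivity
  have hτ : τ = (1 + a * b) ^ 2 * (γ - b) / a := by
    rw [eq_div_iff ha.ne']
    refine mul_right_cancel₀ ha.ne' ?_
    linear_combination -hb
  subst hτ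
  simp only [scalarObjective, rho, abs_of_nonneg hx, abs_of_nonneg hy]
  field_simp
  ring

/-- The stationary point on the branch `2 a (γ - b) ≤ 1 + a b` is a global minimizer once `0` is
known not to be one: that fact excludes both `a (γ - b) > 1 / 2` and `b < 0`. -/
theorem isMinOn_of_stationary {a τ γ b : ℝ} (ha : 0 < a) (hτ : 0 < τ) (hγ : 0 ≤ γ)
    (hb : (1 + a * b) ^ 2 * (a * (γ - b)) = τ * a ^ 2)
    (hlarge : 2 * (a * (γ - b)) ≤ 1 + a * b)
    (hex : ∃ β, 0 < β ∧ scalarObjective a τ γ β < scalarObjective a τ γ 0) :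
    IsMinOn (scalarObjective a τ γ) Set.univ b := by
  obtain ⟨β, hβ, hlt⟩ := hex
  rw [← sub_neg, scalarObjective_sub_of_nonneg ha hβ.le le_rfl hb] at hlt
  set e := a * (γ - b) with he
  have he0 : 0 < e := pos_of_mul_pos_right (hb ▸ (by positivity)) (sq_nonneg (1 + a * b))
  have hβ1 : 1 ≤ a * β + 1 := le_add_of_nonneg_left (by positivity)
  have hdiv : e / (a * β + 1) ≤ e := div_le_self he0.le hβ1
  rw [mul_zero, zero_add, div_one, zero_sub, neg_sq] at hlt
  have hhalf : e ≤ 1 / 2 := by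
    -- Otherwise the product form is negative at `β`, which forces `β` into `(0, b)`, where both
    -- factors are smaller in absolute value than at `0`.
    by_contra! hgt
    have hb0 : 0 < b := pos_of_mul_pos_right (a := a) (by linarith) ha.le
    have hneg : 1 / 2 - e / (a * β + 1) < 0 := by
      by_contra! h0
      nlinarith [mul_nonneg (sq_nonneg (β - b)) h0, mul_pos (pow_pos hb0 2) (sub_pos.mpr hgt)]
    have h2 : a * β + 1 < 2 * e := by
      rw [sub_neg, lt_div_iff₀ (by linarith)] at hneg
      linarith
    have hβb : β < b := lt_of_mul_lt_mul_left (by linarith : a * β < a * b) ha.le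
    have h3 : (β - b) ^ 2 ≤ b ^ 2 := by nlinarith
    nlinarith [mul_le_mul h3 (by linarith : e / (a * β + 1) - 1 / 2 ≤ e - 1 / 2) (by linarith)
      (sq_nonneg b)]
  have hb0 : 0 ≤ b := by
    -- For `b < 0` both factors are nonnegative and increase on `[0, ∞)`.
    by_contra! hbn
    have h3 : b ^ 2 ≤ (β - b) ^ 2 := by nlinarith
    nlinarith [mul_le_mul h3 (by linarith : 1 / 2 - e ≤ 1 / 2 - e / (a * β + 1)) (by linarith)
      (sq_nonneg (β - b))]
  refine isMinOn_scalarObjective_of_nonneg hγ fun x hx => ?_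
  rw [← sub_nonneg, scalarObjective_sub_of_nonneg ha hx hb0 hb, sub_self, ← he]
  have hx1 : e / (a * x + 1) ≤ e := div_le_self he0.le (le_add_of_nonneg_left (by positivity))
  have := mul_nonneg (sq_nonneg (x - b)) (by linarith : 0 ≤ 1 / 2 - e / (a * x + 1))
  linarith

/-- The closed form `scalarProx` computes a scalar minimizer at every `γ ≥ 0`; singular values being
nonnegative, other arguments do not occur. -/
theorem isMinOn_scalarProx {a τ γ : ℝ} (ha : 0 < a) (hτ : 0 < τ) (hγ : 0 ≤ γ) :
    IsMinOn (scalarObjective a τ γ) Set.univ (scalarProx a τ γ) := by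
  unfold scalarProx
  rw [abs_of_nonneg hγ]
  split_ifs with h
  · have hγ0 : 0 < γ := (threshold_pos ha hτ).trans h
    obtain ⟨h1, h2⟩ := cubic_trig_root (c := 1 + a * γ) (k := τ * a ^ 2) (by positivity)
      (by positivity) (by linarith [le_four_mul_cube_of_threshold_lt ha hτ h]) rfl
    unfold shrink angle
    rw [Real.sign_of_pos hγ0, one_mul, abs_of_pos hγ0, mul_assoc 27 τ]
    set s := (1 + a * γ) / 3 * (1 + 2 * Real.cos
      (Real.arccos (27 * (τ * a ^ 2) / (2 * (1 + a * γ) ^ 3) - 1) / 3 - Real.pi / 3))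
    have hs : a * ((s - 1) / a) = s - 1 := by field_simp
    refine isMinOn_of_stationary ha hτ hγ ?_ ?_ (exists_scalarObjective_lt_zero ha hτ h)
    · rw [mul_sub, hs]
      linear_combination h1
    · rw [mul_sub, hs]
      linarith
  · exact isMinOn_zero_of_le_threshold ha hτ hγ (not_lt.mp h)

/-! ### Singular bases and the dual bound for the Frobenius distance -/

/-- A singular value decomposition of `T`, with a family `u` of left singular vectors that is only
required to satisfy Bessel's inequality: `u j = 0` where the `j`-th singular value vanishes, so that
no completion to an orthonormal family is needed. -/
theorem exists_singular_value_decomposition {E F : Type*}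
    [NormedAddCommGroup E] [InnerProductSpace ℝ E] [FiniteDimensional ℝ E]
    [NormedAddCommGroup F] [InnerProductSpace ℝ F] [FiniteDimensional ℝ F]
    (T : E →ₗ[ℝ] F) {n : ℕ} (hn : finrank ℝ E = n) :
    ∃ (v : OrthonormalBasis (Fin n) ℝ E) (u : Fin n → F),
      (∀ j, T (v j) = T.singularValues j • u j) ∧
        ∀ x, ∑ j, inner ℝ (u j) x ^ 2 ≤ ‖x‖ ^ 2 := by
  set v := T.isSymmetric_adjoint_comp_self.eigenvectorBasis hn with hv
  have hTT (i j : Fin n) : inner ℝ (T (v i)) (T (v j)) =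
      if i = j then T.singularValues i ^ 2 else 0 := by
    have h1 : (T.adjoint ∘ₗ T) (v j) = T.singularValues j ^ 2 • v j := by
      rw [T.sq_singularValues_fin hn j]
      exact T.isSymmetric_adjoint_comp_self.apply_eigenvectorBasis hn j
    rw [← LinearMap.adjoint_inner_right]
    rw [LinearMap.comp_apply] at h1
    rw [h1, inner_smul_right, orthonormal_iff_ite.mp v.orthonormal i j]
    split_ifs with h
    · rw [h, mul_one]
    · rw [mul_zero]
  refine ⟨v, fun j => (T.singularValues j)⁻¹ • T (v j), fun j => ?_, fun x => ?_⟩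
  · by_cases h : T.singularValues j = 0
    · have h2 := hTT j j
      rw [if_pos rfl, h, zero_pow two_ne_zero, inner_self_eq_zero] at h2
      simp only [h2, smul_zero]
    · simp only [smul_inv_smul₀ h]
  · -- Bessel's inequality applies to the subfamily with nonzero singular values.
    have ho : Orthonormal ℝ (fun j : {j : Fin n // T.singularValues j ≠ 0} =>
        (T.singularValues j.1)⁻¹ • T (v j.1)) := by
      rw [orthonormal_iff_ite]
      rintro ⟨i, hi⟩ ⟨j, hj⟩
      rw [real_inner_smul_left, real_inner_smul_right, hTT]
      by_cases h : i = j
      · subst h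
        simp only [if_true]
        field_simp
      · simp [h]
    have hb := ho.sum_inner_products_le (s := Finset.univ) x
    refine le_trans (le_of_eq ?_) hb
    rw [← Fintype.sum_subtype_add_sum_subtype (fun j : Fin n => T.singularValues j ≠ 0)]
    have h0 : ∑ j : {j : Fin n // ¬ T.singularValues j ≠ 0},
        inner ℝ ((T.singularValues j.1)⁻¹ • T (v j.1)) x ^ 2 = 0 :=
      Finset.sum_eq_zero fun j _ => by simp [not_not.mp j.2]
    rw [h0, add_zero]
    simp only [Real.norm_eq_abs, sq_abs]

theorem norm_le_one_of_bessel {F ι : Type*} [Fintype ι]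
    [NormedAddCommGroup F] [InnerProductSpace ℝ F] {u : ι → F}
    (hu : ∀ x, ∑ j, inner ℝ (u j) x ^ 2 ≤ ‖x‖ ^ 2) (i : ι) : ‖u i‖ ≤ 1 := by
  have h := (Finset.single_le_sum (f := fun j => inner ℝ (u j) (u i) ^ 2)
    (fun j _ => sq_nonneg _) (Finset.mem_univ i)).trans (hu (u i))
  simp only [real_inner_self_eq_norm_sq] at h
  by_contra! h1
  have h2 : 1 < ‖u i‖ ^ 2 := by nlinarith
  nlinarith

/-- Weak duality for the assignment problem: a dual feasible pair `(f, g)` bounds the value of the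
cost `c` on every doubly substochastic `P`. -/
theorem sum_mul_le_sum_add_sum_of_substochastic {ι κ : Type*} [Fintype ι] [Fintype κ]
    {P : ι → κ → ℝ} (hP : ∀ i j, 0 ≤ P i j) (hrow : ∀ i, ∑ j, P i j ≤ 1)
    (hcol : ∀ j, ∑ i, P i j ≤ 1) {f : ι → ℝ} {g : κ → ℝ} (hf : ∀ i, 0 ≤ f i)
    (hg : ∀ j, 0 ≤ g j) {c : ι → κ → ℝ} (hc : ∀ i j, c i j ≤ f i + g j) :
    ∑ i, ∑ j, c i j * P i j ≤ ∑ i, f i + ∑ j, g j := by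
  calc ∑ i, ∑ j, c i j * P i j ≤ ∑ i, ∑ j, (f i + g j) * P i j := by
        gcongr with i _ j _
        · exact hP i j
        · exact hc i j
    _ = ∑ i, f i * ∑ j, P i j + ∑ j, g j * ∑ i, P i j := by
        simp_rw [add_mul, Finset.sum_add_distrib, Finset.mul_sum]
        congr 1
        exact Finset.sum_comm
    _ ≤ _ := by
        gcongr with i _ j _
        · exact mul_le_of_le_one_right (hf i) (hrow i)
        · exact mul_le_of_le_one_right (hg j) (hcol j)

theorem frobenius_norm_sq_eq_trace {m n : ℕ} (A : Matrix (Fin m) (Fin n) ℝ) :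
    ‖A‖ ^ 2 = (Aᵀ * A).trace := by
  rw [Matrix.frobenius_norm_def, ← Real.sqrt_eq_rpow, Real.sq_sqrt (by positivity)]
  simp only [Matrix.trace, Matrix.diag, Matrix.mul_apply, Matrix.transpose_apply]
  rw [Finset.sum_comm]
  simp [sq]

theorem adjoint_comp_toEuclideanLin {m n : ℕ} (A : Matrix (Fin m) (Fin n) ℝ) :
    (Matrix.toEuclideanLin A).adjoint ∘ₗ Matrix.toEuclideanLin A =
      Matrix.toEuclideanLin (Aᵀ * A) := by
  rw [← Matrix.toEuclideanLin_conjTranspose_eq_adjoint, Matrix.conjTranspose_eq_transpose_of_trivial]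
  ext x
  simp [Matrix.toLpLin_apply]

theorem frobenius_norm_sq_eq_sum {m n : ℕ} {ι : Type*} [Fintype ι]
    (A : Matrix (Fin m) (Fin n) ℝ) (v : OrthonormalBasis ι ℝ (EuclideanSpace ℝ (Fin n))) :
    ‖A‖ ^ 2 = ∑ j, ‖Matrix.toEuclideanLin A (v j)‖ ^ 2 := by
  classical
  have h (j : ι) : ‖Matrix.toEuclideanLin A (v j)‖ ^ 2 =
      inner ℝ (v j) (Matrix.toEuclideanLin (Aᵀ * A) (v j)) := by
    rw [← adjoint_comp_toEuclideanLin, LinearMap.comp_apply, LinearMap.adjoint_inner_right,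
      real_inner_self_eq_norm_sq]
  simp_rw [h]
  rw [← LinearMap.trace_eq_sum_inner, frobenius_norm_sq_eq_trace,
    Matrix.toEuclideanLin_eq_toLin_orthonormal, Matrix.trace_toLin_eq]

theorem singularVector_nonneg {m n : ℕ} (Z : Matrix (Fin m) (Fin n) ℝ) (i : Fin n) :
    0 ≤ singularVector Z i := LinearMap.singularValues_nonneg _ _

theorem frobenius_norm_sq_eq_sum_singularVector {m n : ℕ} (Z : Matrix (Fin m) (Fin n) ℝ) :
    ‖Z‖ ^ 2 = ∑ i, singularVector Z i ^ 2 := by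
  set v := (Matrix.toEuclideanLin Z).isSymmetric_adjoint_comp_self.eigenvectorBasis
    (finrank_euclideanSpace_fin (𝕜 := ℝ)) with hv
  rw [frobenius_norm_sq_eq_sum Z v]
  refine Finset.sum_congr rfl fun j _ => ?_
  rw [← real_inner_self_eq_norm_sq, ← LinearMap.adjoint_inner_right, ← LinearMap.comp_apply, hv,
    LinearMap.IsSymmetric.apply_eigenvectorBasis, inner_smul_right, real_inner_self_eq_norm_sq,
    OrthonormalBasis.norm_eq_one, singularVector,
    LinearMap.sq_singularValues_fin _ (finrank_euclideanSpace_fin (𝕜 := ℝ))]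
  simp

/-- A dual form of the von Neumann trace inequality: `∑ f + ∑ g` bounds the Frobenius inner product
of `Z` and `N` as soon as `f ≥ 0`, `g ≥ 0` and `f i + g j ≥ σᵢ(Z) σⱼ(N)`. -/
theorem half_sq_sub_le_half_frobenius_norm_sub_sq {m n : ℕ}
    (Z N : Matrix (Fin m) (Fin n) ℝ) {f g : Fin n → ℝ}
    (hf : ∀ i, 0 ≤ f i) (hg : ∀ i, 0 ≤ g i)
    (hfg : ∀ i j, singularVector Z i * singularVector N j ≤ f i + g j) :
    1 / 2 * (∑ i, singularVector Z i ^ 2 + ∑ i, singularVector N i ^ 2) - (∑ i, f i + ∑ i, g i)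
      ≤ 1 / 2 * ‖Z - N‖ ^ 2 := by
  obtain ⟨v, u, hZ, hu⟩ := exists_singular_value_decomposition (Matrix.toEuclideanLin Z)
    (finrank_euclideanSpace_fin (𝕜 := ℝ))
  obtain ⟨b, w, hN, hw⟩ := exists_singular_value_decomposition (Matrix.toEuclideanLin N)
    (finrank_euclideanSpace_fin (𝕜 := ℝ))
  have hexp : ‖Z - N‖ ^ 2 = ‖Z‖ ^ 2 + ‖N‖ ^ 2 -
      2 * ∑ j, inner ℝ (Matrix.toEuclideanLin Z (v j)) (Matrix.toEuclideanLin N (v j)) := by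
    rw [frobenius_norm_sq_eq_sum _ v, frobenius_norm_sq_eq_sum Z v, frobenius_norm_sq_eq_sum N v,
      Finset.mul_sum, ← Finset.sum_add_distrib, ← Finset.sum_sub_distrib]
    refine Finset.sum_congr rfl fun j _ => ?_
    rw [map_sub, LinearMap.sub_apply, norm_sub_sq_real]
    ring
  have hcross (j : Fin n) :
      inner ℝ (Matrix.toEuclideanLin Z (v j)) (Matrix.toEuclideanLin N (v j)) =
        ∑ i, singularVector Z j * singularVector N i *
          (inner ℝ (b i) (v j) * inner ℝ (u j) (w i)) := by
    have hNv : Matrix.toEuclideanLin N (v j) =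
        ∑ i, inner ℝ (b i) (v j) • singularVector N i • w i := by
      conv_lhs => rw [← b.sum_repr' (v j)]
      simp only [map_sum, map_smul, hN, singularVector]
    rw [hZ, hNv, inner_sum]
    refine Finset.sum_congr rfl fun i _ => ?_
    rw [real_inner_smul_left, real_inner_smul_right, real_inner_smul_right, singularVector,
      singularVector]
    ring
  have hle : ∑ j, inner ℝ (Matrix.toEuclideanLin Z (v j)) (Matrix.toEuclideanLin N (v j)) ≤
      ∑ i, f i + ∑ i, g i := by
    simp_rw [hcross]
    -- The product of two overlaps is at most the mean of their squares, and the squares form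
    -- doubly substochastic matrices by Bessel's inequality.
    have hP := sum_mul_le_sum_add_sum_of_substochastic
      (P := fun j i => (inner ℝ (b i) (v j) ^ 2 + inner ℝ (u j) (w i) ^ 2) / 2)
      (fun i j => by positivity) (fun j => ?_) (fun i => ?_) hf hg hfg
    · refine le_trans ?_ hP
      gcongr with j _ i _
      · exact mul_nonneg (singularVector_nonneg Z j) (singularVector_nonneg N i)
      · nlinarith [sq_nonneg (inner ℝ (b i) (v j) - inner ℝ (u j) (w i))]
    · have h1 := b.sum_sq_inner_right (v j)
      have h2 := hw (u j)
      have h3 := norm_le_one_of_bessel hu j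
      rw [v.norm_eq_one] at h1
      simp_rw [real_inner_comm (w _) (u j)]
      rw [← Finset.sum_div, Finset.sum_add_distrib, h1]
      nlinarith [norm_nonneg (u j)]
    · have h1 := v.sum_sq_inner_left (b i)
      have h2 := hu (w i)
      have h3 := norm_le_one_of_bessel hw i
      rw [b.norm_eq_one] at h1
      rw [← Finset.sum_div, Finset.sum_add_distrib, h1]
      nlinarith [norm_nonneg (w i)]
  rw [hexp, frobenius_norm_sq_eq_sum_singularVector Z, frobenius_norm_sq_eq_sum_singularVector N]
  linarith

/-! ### Matrices in factored form -/

theorem charpoly_gram_eq_prod {m n : ℕ} (Z : Matrix (Fin m) (Fin n) ℝ) :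
    (Zᵀ * Z).charpoly = ∏ i, (Polynomial.X - Polynomial.C (singularVector Z i ^ 2)) := by
  have h := (Matrix.toEuclideanLin Z).isSymmetric_adjoint_comp_self.charpoly_eq
    (finrank_euclideanSpace_fin (𝕜 := ℝ))
  simp only [← LinearMap.sq_singularValues_fin] at h
  rw [adjoint_comp_toEuclideanLin, Matrix.toEuclideanLin_eq_toLin_orthonormal,
    ← LinearMap.charpoly_toMatrix _ (EuclideanSpace.basisFun (Fin n) ℝ).toBasis,
    LinearMap.toMatrix_toLin] at h
  exact h

theorem rectDiag_gram {m n : ℕ} (hmn : n ≤ m) (d : Fin n → ℝ) :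
    (rectDiag m d)ᵀ * rectDiag m d = Matrix.diagonal fun i => d i ^ 2 := by
  ext i j
  rw [Matrix.mul_apply, Finset.sum_eq_single (Fin.castLE hmn i)]
  · by_cases h : i = j
    · subst h; simp [rectDiag, sq]
    · simp [rectDiag, h, Fin.val_inj]
  · intro l _ hl
    have : (l : ℕ) ≠ i := fun h => hl (Fin.ext h)
    simp [rectDiag, this]
  · simp

theorem gram_mul_rectDiag_mul {m n : ℕ} (hmn : n ≤ m) {U : Matrix (Fin m) (Fin m) ℝ}
    {V : Matrix (Fin n) (Fin n) ℝ} (hU : U ∈ Matrix.orthogonalGroup (Fin m) ℝ)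
    (d : Fin n → ℝ) :
    (U * rectDiag m d * Vᵀ)ᵀ * (U * rectDiag m d * Vᵀ) =
      V * (Matrix.diagonal fun i => d i ^ 2) * Vᵀ := by
  have hU' : Uᵀ * U = 1 := (Matrix.mem_orthogonalGroup_iff' _ _).mp hU
  rw [← rectDiag_gram hmn]
  simp only [Matrix.transpose_mul, Matrix.transpose_transpose, Matrix.mul_assoc]
  rw [← Matrix.mul_assoc Uᵀ U, hU', Matrix.one_mul]

theorem frobenius_norm_sq_mul_rectDiag_mul {m n : ℕ} (hmn : n ≤ m) {U : Matrix (Fin m) (Fin m) ℝ}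
    {V : Matrix (Fin n) (Fin n) ℝ} (hU : U ∈ Matrix.orthogonalGroup (Fin m) ℝ)
    (hV : V ∈ Matrix.orthogonalGroup (Fin n) ℝ) (d : Fin n → ℝ) :
    ‖U * rectDiag m d * Vᵀ‖ ^ 2 = ∑ i, d i ^ 2 := by
  rw [frobenius_norm_sq_eq_trace, gram_mul_rectDiag_mul hmn hU, Matrix.trace_mul_comm,
    ← Matrix.mul_assoc,
    show Vᵀ * V = 1 from (Matrix.mem_orthogonalGroup_iff' _ _).mp hV, Matrix.one_mul,
    Matrix.trace_diagonal]

theorem roots_prod_X_sub_C_eq_map {n : ℕ} (x : Fin n → ℝ) :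
    (∏ i, (Polynomial.X - Polynomial.C (x i))).roots = Finset.univ.val.map x := by
  rw [← Polynomial.roots_multiset_prod_X_sub_C (Finset.univ.val.map x), Multiset.map_map]
  rfl

/-- The squared singular values of `U [Diag(d); 0] Vᵀ` are the `d i ^ 2` up to order, because both
families are the roots of the characteristic polynomial of the Gram matrix; `d` may have any signs
and need not be sorted. -/
theorem sum_singularVector_sq_mul_rectDiag_mul {m n : ℕ} (hmn : n ≤ m)
    {U : Matrix (Fin m) (Fin m) ℝ} {V : Matrix (Fin n) (Fin n) ℝ}
    (hU : U ∈ Matrix.orthogonalGroup (Fin m) ℝ)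
    (hV : V ∈ Matrix.orthogonalGroup (Fin n) ℝ) (d : Fin n → ℝ) (F : ℝ → ℝ) :
    ∑ i, F (singularVector (U * rectDiag m d * Vᵀ) i ^ 2) = ∑ i, F (d i ^ 2) := by
  have h := charpoly_gram_eq_prod (U * rectDiag m d * Vᵀ)
  have hV' : Vᵀ * V = 1 := (Matrix.mem_orthogonalGroup_iff' _ _).mp hV
  rw [gram_mul_rectDiag_mul hmn hU, Matrix.mul_assoc, Matrix.charpoly_mul_comm, Matrix.mul_assoc, hV',
    Matrix.mul_one, Matrix.charpoly_diagonal] at h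
  have h2 := congrArg (fun p => (p.roots.map F).sum) h
  rw [roots_prod_X_sub_C_eq_map, roots_prod_X_sub_C_eq_map] at h2
  rw [Multiset.map_map, Multiset.map_map] at h2
  exact h2.symm

/-! ### The matrix minimization problem -/

/-- Applying a scalar minimizer to each singular value of `N` minimizes the matrix objective. Neither
monotonicity nor a sign condition on `h` is needed. -/
theorem isMinOn_singularValueThreshold {m n : ℕ} (hmn : n ≤ m) {a τ : ℝ} (ha : 0 < a)
    (hτ : 0 < τ) {N : Matrix (Fin m) (Fin n) ℝ} {U : Matrix (Fin m) (Fin m) ℝ}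
    {V : Matrix (Fin n) (Fin n) ℝ} (hN : IsSVD N U V) {h : ℝ → ℝ}
    (hh : ∀ γ, 0 ≤ γ → IsMinOn (scalarObjective a τ γ) Set.univ (h γ)) :
    IsMinOn (matrixObjective a τ N) Set.univ (singularValueThreshold h N U V) := by
  have hmin (i : Fin n) (β : ℝ) :
      scalarObjective a τ (singularVector N i) (h (singularVector N i)) ≤
        scalarObjective a τ (singularVector N i) β :=
    hh _ (singularVector_nonneg N i) (Set.mem_univ β)
  have hvalue : matrixObjective a τ N (singularValueThreshold h N U V) =
      ∑ i, scalarObjective a τ (singularVector N i) (h (singularVector N i)) := by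
    have hsub : singularValueThreshold h N U V - N =
        U * rectDiag m (fun i => h (singularVector N i) - singularVector N i) * Vᵀ := by
      have hd : rectDiag m (fun i => h (singularVector N i) - singularVector N i) =
          rectDiag m (vectorThreshold h (singularVector N)) - rectDiag m (singularVector N) := by
        ext l j
        by_cases hlj : (l : ℕ) = j <;> simp [rectDiag, vectorThreshold, hlj]
      rw [hd, Matrix.mul_sub, Matrix.sub_mul, ← hN.eq, singularValueThreshold]
    have hrho : ∑ i, rho a (singularVector (singularValueThreshold h N U V) i) =
        ∑ i, rho a (h (singularVector N i)) := by
      have := sum_singularVector_sq_mul_rectDiag_mul hmn hN.left_orthogonal hN.right_orthogonal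
        (vectorThreshold h (singularVector N)) (fun y => rho a √y)
      simp only [Real.sqrt_sq_eq_abs, rho_abs] at this
      exact this
    unfold matrixObjective
    rw [hrho, hsub, frobenius_norm_sq_mul_rectDiag_mul hmn hN.left_orthogonal hN.right_orthogonal,
      Finset.mul_sum, Finset.mul_sum, ← Finset.sum_add_distrib]
    rfl
  intro Z _
  change matrixObjective a τ N (singularValueThreshold h N U V) ≤ matrixObjective a τ N Z
  rw [hvalue]
  -- The dual pair: the scalar objective at `γ = 0` for `Z`, and `γ² / 2` minus the optimal scalar
  -- value for `N`. Feasibility is the optimality of `h`.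
  have hkey := half_sq_sub_le_half_frobenius_norm_sub_sq Z N
    (f := fun i => 1 / 2 * singularVector Z i ^ 2 + τ * rho a (singularVector Z i))
    (g := fun i => 1 / 2 * singularVector N i ^ 2 -
      scalarObjective a τ (singularVector N i) (h (singularVector N i)))
    (fun i => by have := rho_nonneg ha (singularVector Z i); positivity)
    (fun i => by
      have := hmin i 0
      simp only [scalarObjective, rho, abs_zero, mul_zero, zero_div, add_zero] at this ⊢
      linarith)
    (fun i j => by
      have := hmin j (singularVector Z i)
      simp only [scalarObjective] at this ⊢
      linarith)
  simp only [Finset.sum_add_distrib, Finset.sum_sub_distrib, ← Finset.mul_sum] at hkey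
  unfold matrixObjective
  linarith

end FractionThresholding

theorem lemma2 {m n : ℕ} (hmn : n ≤ m) {a τ : ℝ} (ha : 0 < a) (hτ : 0 < τ)
    (N : Matrix (Fin m) (Fin n) ℝ) (U : Matrix (Fin m) (Fin m) ℝ) (V : Matrix (Fin n) (Fin n) ℝ)
    (hN : FractionThresholding.IsSVD N U V) :
    (∀ h : ℝ → ℝ, FractionThresholding.IsScalarProx a τ h →
      IsMinOn (FractionThresholding.matrixObjective a τ N) Set.univ
        (FractionThresholding.singularValueThreshold h N U V)) ∧
    IsMinOn (FractionThresholding.matrixObjective a τ N) Set.univ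
      (FractionThresholding.singularValueThreshold
        (FractionThresholding.scalarProx a τ) N U V) :=
  ⟨fun _ hh => FractionThresholding.isMinOn_singularValueThreshold hmn ha hτ hN fun γ _ => hh γ,
    FractionThresholding.isMinOn_singularValueThreshold hmn ha hτ hN fun _ hγ =>
      FractionThresholding.isMinOn_scalarProx ha hτ hγ⟩
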